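/- Let $G$ be a finite loopless undirected multigraph (parallel edges allowed) with nonnegative real edge weights $\mathbf w=(w_e)_{e\in E(G)}$. For a subgraph $H$ put $w(H)=\prod_{e\in E(H)}w_e$, and let $\Delta=\max_{x\in V(G)}\sum_{e\ni x}w_e$ be the maximum weighted degree. A vertex $x$ of a graph $H$ is a *cut vertex* if $H\setminus x$ has more components than $H$, and an *internal vertex* otherwise. A *block* of $H$ is a maximal non-separable subgraph of $H$, where non-separable means connected and without cut vertices. An *isolated block* of $H$ is a block containing no cut vertex of $H$; an *end block* of $H$ is a block containing exactly one cut vertex of $H$. For a block $B$ of $H$, let $\mathrm{Int}(B,H)$ be the set of internal vertices of $H$ that lie in $B$. For $X,Y\subseteq V(G)$ with $Y\ne\emptyset$, let $\mathcal{BF}_m(X,Y)$ be the set of $m$-edge subgraphs $H$ of $G$ (connected or not) such that: $X\cup Y\subseteq V(H)$; each component of $H$ contains exactly one vertex of $Y$; $\mathrm{Int}(B,H)\cap(X\cup Y)\neq\emptyset$ for each end block $B$ of $H$; and each isolated block of $H$ is either an isolated vertex belonging to $Y$ or contains at least two vertices of $X\cup Y$. For nonempty $X\subseteq V(G)$, let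 $\mathcal{BT}_m(X)$ be the set of connected $m$-edge subgraphs $H$ of $G$ such that: $X\subseteq V(H)$; $\mathrm{Int}(B,H)\cap X\ne\emptyset$ for each end block $B$ of $H$; and, if $H$ is a block, then $H$ is an isolated vertex or contains at least two vertices of $X$. Put $bf_m(X,Y)=\sum_{H\in\mathcal{BF}_m(X,Y)}w(H)$ and $bt_m(X)=\sum_{H\in\mathcal{BT}_m(X)}w(H)$. (a) For all $X,Y\subseteq V(G)$ with $Y\neq\emptyset$, $$\sum_{m=0}^\infty\Bigl(\frac{\Delta}{\ln 2}\Bigr)^{-m}bf_m(X,Y)\le 1 .$$ (b) For all nonempty $X\subseteq V(G)$, $$\sum_{m=0}^\infty\Bigl(\frac{\Delta}{\ln 2}\Bigr)^{-m}bt_m(X)\le 1 .$$ (If $\Delta=0$, then $bf_m=bt_m=0$ for $m\ge1$, and the terms with $m\ge 1$ are read as $0$.) (c) Both bounds are sharp in the following sense: for every $D>0$ and every real $\zeta>(\ln 2)/D$ there are a weighted multigraph $(G,\mathbf w)$ as above with $\Delta=D$ and sets $X,Y\subseteq V(G)$ with $Y\ne\emptyset$ such that $\sum_m\zeta^m bf_m(X,Y)>1$,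 and a nonempty $X'\subseteq V(G)$ such that $\sum_m\zeta^m bt_m(X')>1$. -/

import Mathlib

universe u v

open scoped Graph

noncomputable section

namespace Graph

variable {α : Type u} {β : Type v}

/-- `y` can be reached from `x` by a walk of `H` (possibly of length zero). -/
def WalkReachable (H : Graph α β) (x y : α) : Prop :=
  Relation.ReflTransGen H.Adj x y

/-- The vertex sets of the connected components of `H`. -/
def componentSets (H : Graph α β) : Set (Set α) :=
  {C | ∃ x ∈ V(H), C = {y | H.WalkReachable x y}}

/-- A graph is connected if it is nonempty and any two of its vertices are joined by a walk. -/
def IsConnected (H : Graph α β) : Prop :=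
  V(H).Nonempty ∧ ∀ x ∈ V(H), ∀ y ∈ V(H), H.WalkReachable x y

/-- `x` is a cut vertex of `H` if `H ∖ x` has more components than `H`. -/
def IsCutVertex (H : Graph α β) (x : α) : Prop :=
  x ∈ V(H) ∧ H.componentSets.encard < (H.deleteVerts {x}).componentSets.encard

/-- A graph is non-separable if it is connected and has no cut vertices. -/
def IsNonSeparable (H : Graph α β) : Prop :=
  H.IsConnected ∧ ∀ x, ¬ H.IsCutVertex x

/-- `B` is a block of `H`: a maximal non-separable subgraph of `H`. -/
def IsBlock (H B : Graph α β) : Prop :=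
  Maximal (fun K : Graph α β => K ≤ H ∧ K.IsNonSeparable) B

/-- `Int(B, H)`: the vertices of `B` that are internal in `H`, i.e. not cut vertices of `H`. -/
def internalVerts (B H : Graph α β) : Set α :=
  {x | x ∈ V(B) ∧ x ∈ V(H) ∧ ¬ H.IsCutVertex x}

/-- An isolated block of `H` is a block containing no cut vertex of `H`. -/
def IsIsolatedBlock (H B : Graph α β) : Prop :=
  H.IsBlock B ∧ ∀ x ∈ V(B), ¬ H.IsCutVertex x

/-- An end block of `H` is a block containing exactly one cut vertex of `H`. -/
def IsEndBlock (H B : Graph α β) : Prop :=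
  H.IsBlock B ∧ ∃! x, x ∈ V(B) ∧ H.IsCutVertex x

/-- The set `BT_m(X)` of `m`-edge block trees in `G`, with end blocks tied down on `X`. -/
def blockTrees (G : Graph α β) (m : ℕ) (X : Set α) : Set (Graph α β) :=
  {H | H ≤ G ∧ E(H).encard = m ∧
    X ⊆ V(H) ∧
    H.IsConnected ∧
    (∀ B, H.IsEndBlock B → (internalVerts B H ∩ X).Nonempty) ∧
    (H.IsBlock H → (∃ x, H = Graph.noEdge {x} β) ∨ (V(H) ∩ X).Nontrivial)}

/-- The set `BF_m(X, Y)` of `m`-edge block forests in `G`, with end blocks tied down on `X ∪ Y`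
and components tied down on single elements of `Y`. -/
def blockForests (G : Graph α β) (m : ℕ) (X Y : Set α) : Set (Graph α β) :=
  {H | H ≤ G ∧ E(H).encard = m ∧
    X ∪ Y ⊆ V(H) ∧
    (∀ C ∈ H.componentSets, ∃! y, y ∈ C ∧ y ∈ Y) ∧
    (∀ B, H.IsEndBlock B → (internalVerts B H ∩ (X ∪ Y)).Nonempty) ∧
    (∀ B, H.IsIsolatedBlock B →
      (∃ y ∈ Y, B = Graph.noEdge {y} β) ∨ (V(B) ∩ (X ∪ Y)).Nontrivial)}

/-- The weight `w(H)` of a subgraph: the product of its edge weights. -/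
def weight (w : β → ℝ) (H : Graph α β) : ℝ :=
  ∏ᶠ e ∈ E(H), w e

/-- The weighted count `bt_m(X)`. -/
def blockTreeCount (G : Graph α β) (w : β → ℝ) (m : ℕ) (X : Set α) : ℝ :=
  ∑ᶠ H ∈ G.blockTrees m X, weight w H

/-- The weighted count `bf_m(X, Y)`. -/
def blockForestCount (G : Graph α β) (w : β → ℝ) (m : ℕ) (X Y : Set α) : ℝ :=
  ∑ᶠ H ∈ G.blockForests m X Y, weight w H

/-- The weighted degree of a vertex: the sum of the weights of the edges incident with it. -/
def weightedDegree (G : Graph α β) (w : β → ℝ) (x : α) : ℝ :=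
  ∑ᶠ e ∈ G.incidenceSet x, w e

/-- The maximum weighted degree `Δ(G, w)` (a maximum when `V(G)` is finite and nonempty). -/
def maxWeightedDegree (G : Graph α β) (w : β → ℝ) : ℝ :=
  sSup (G.weightedDegree w '' V(G))

/-- `(G, w)` is a finite loopless multigraph with nonnegative real edge weights. -/
structure IsWeightedMultigraph (G : Graph α β) (w : β → ℝ) : Prop where
  finite_vertexSet : V(G).Finite
  finite_edgeSet : E(G).Finite
  loopless : G.Loopless
  weight_nonneg : ∀ e ∈ E(G), 0 ≤ w e

end Graph

end

noncomputable section

namespace Graph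

variable {α : Type u} {β : Type v} {G H K : Graph α β} {a b u v x y : α} {Z X Y : Set α}

/-! ### Walks -/

/-! The block conditions are used only through a weaker, edge-deletion-friendly one, `tiedForests Z
Y`: each component of `H` has a single root in `Y`, and whatever remains after removing one vertex
still meets `Z`. Block forests satisfy it with `Z = X ∪ Y`, block trees with `Z = X` and any one `x
∈ X` as root. The reason is that a component of `H ∖ v` attached to `v` and missing `Z` would
contain all but one vertex of an end block or isolated block, contradicting how that block is tied
down (`exists_lobe_isBlock`, `exists_walkReachable_deleteVerts`).

For `x ∈ Z \ Y`, let `S` be the edges of `H` from `x` to the part of `H ∖ x` that meets `Y`. Then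
`S` is nonempty, and deleting it makes `x` a new root and adds the ends of `S` to `Z`
(`deleteEdges_rootEdges_mem_tiedForests`). By induction the total weight is at most the sum over
nonempty sets `S` of edges at `x` of `∏ w`, which is `∏ (1 + w e) - 1 ≤ exp (deg x) - 1 ≤ 1` once
degrees are at most `ln 2`. When `Z = Y` only the edgeless graph on `Y` is left.

For sharpness, take two vertices joined by `n` parallel edges of weight `D / n`: every nonempty edge
set counts, giving at least `(1 + ζ D / n) ^ n - 1`, which tends to `exp (ζ D) - 1 > 1`. -/

lemma WalkReachable.refl (H : Graph α β) (x : α) : H.WalkReachable x x :=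
  Relation.ReflTransGen.refl

lemma WalkReachable.trans (h : H.WalkReachable a b) (h' : H.WalkReachable b x) :
    H.WalkReachable a x :=
  Relation.ReflTransGen.trans h h'

lemma WalkReachable.symm (h : H.WalkReachable a b) : H.WalkReachable b a := by
  induction h with
  | refl => exact .refl _ _
  | tail _ hbc ih => exact Relation.ReflTransGen.head hbc.symm ih

lemma Adj.walkReachable (h : H.Adj a b) : H.WalkReachable a b :=
  Relation.ReflTransGen.single h

lemma WalkReachable.mono (hle : K ≤ H) (h : K.WalkReachable a b) : H.WalkReachable a b :=
  Relation.ReflTransGen.mono (fun _ _ ↦ Adj.mono hle) a b h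

lemma WalkReachable.mem (h : H.WalkReachable a b) (ha : a ∈ V(H)) : b ∈ V(H) := by
  induction h with
  | refl => exact ha
  | tail _ hbc _ => exact hbc.right_mem

lemma deleteVerts_singleton_adj :
    (H.deleteVerts {v}).Adj a b ↔ H.Adj a b ∧ a ≠ v ∧ b ≠ v := by
  simp [Adj]

lemma WalkReachable.of_deleteVerts (h : (H.deleteVerts {v}).WalkReachable a b) :
    H.WalkReachable a b :=
  h.mono deleteVerts_le

lemma WalkReachable.ne_of_deleteVerts (h : (H.deleteVerts {v}).WalkReachable a b) (ha : a ≠ v) :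
    b ≠ v := by
  induction h with
  | refl => exact ha
  | tail _ hbc _ => exact (deleteVerts_singleton_adj.1 hbc).2.2

lemma deleteVerts_mono (hle : K ≤ H) (v : α) : K.deleteVerts {v} ≤ H.deleteVerts {v} := by
  refine ⟨?_, fun e x y h ↦ ?_⟩
  · simp only [vertexSet_deleteVerts]
    exact Set.sdiff_subset_sdiff_left hle.vertexSet_mono
  · simp only [deleteVerts_isLink] at h ⊢
    exact ⟨h.1.mono hle, h.2⟩

/-- A walk either avoids `v`, or leads to a neighbour of `v` before it meets `v`. -/
lemma WalkReachable.deleteVerts_or (h : H.WalkReachable a b) (ha : a ≠ v) :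
    (b ≠ v ∧ (H.deleteVerts {v}).WalkReachable a b) ∨
      ∃ n, H.Adj n v ∧ (H.deleteVerts {v}).WalkReachable a n := by
  induction h with
  | refl => exact .inl ⟨ha, .refl _ _⟩
  | @tail b c _ hbc ih =>
    rcases ih with ⟨hb, ih⟩ | ih
    · by_cases hc : c = v
      · exact .inr ⟨b, hc ▸ hbc, ih⟩
      · exact .inl ⟨hc, ih.trans (deleteVerts_singleton_adj.2 ⟨hbc, hb, hc⟩).walkReachable⟩
    · exact .inr ih

/-! ### Cut vertices -/

/-- Sending each component of `H ∖ v` to the component of `H` around it is injective under `h`, so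
deleting `v` does not increase their number. -/
lemma not_isCutVertex_of_walkReachable
    (h : ∀ a ∈ V(H), ∀ b ∈ V(H), a ≠ v → b ≠ v → H.WalkReachable a b →
      (H.deleteVerts {v}).WalkReachable a b) : ¬ H.IsCutVertex v := by
  rintro ⟨-, hlt⟩
  refine hlt.not_ge ?_
  have key : ∀ x, {y | ∃ a ∈ {y | (H.deleteVerts {v}).WalkReachable x y}, H.WalkReachable a y} =
      {y | H.WalkReachable x y} := by
    intro x
    ext y
    exact ⟨fun ⟨a, ha, hay⟩ ↦ WalkReachable.trans (WalkReachable.of_deleteVerts ha) hay,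
      fun hy ↦ ⟨x, .refl _ _, hy⟩⟩
  refine Set.encard_le_encard_of_injOn (f := fun D ↦ {y | ∃ a ∈ D, H.WalkReachable a y}) ?_ ?_
  · rintro _ ⟨x, hx, rfl⟩
    exact ⟨x, deleteVerts_le.vertexSet_mono hx, key x⟩
  · rintro _ ⟨x, hx, rfl⟩ _ ⟨x', hx', rfl⟩ heq
    simp only [key] at heq
    have hmem : x' ∈ {y | H.WalkReachable x y} := heq ▸ WalkReachable.refl H x'
    simp only [vertexSet_deleteVerts, Set.mem_sdiff, Set.mem_singleton_iff] at hx hx'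
    have hr := h x hx.1 x' hx'.1 hx.2 hx'.2 hmem
    ext y
    exact ⟨fun hy ↦ hr.symm.trans hy, fun hy ↦ hr.trans hy⟩

lemma IsConnected.componentSets_eq (h : H.IsConnected) : H.componentSets = {V(H)} := by
  ext C
  constructor
  · rintro ⟨x, hx, rfl⟩
    ext y
    exact ⟨fun hy ↦ hy.mem hx, fun hy ↦ h.2 x hx y hy⟩
  · rintro rfl
    obtain ⟨x, hx⟩ := h.1
    refine ⟨x, hx, ?_⟩
    ext y
    exact ⟨fun hy ↦ h.2 x hx y hy, fun hy ↦ hy.mem hx⟩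

lemma IsConnected.walkReachable_deleteVerts (h : H.IsConnected) (hv : v ∈ V(H))
    (hcut : ¬ H.IsCutVertex v) (ha : a ∈ V(H)) (hb : b ∈ V(H)) (hav : a ≠ v) (hbv : b ≠ v) :
    (H.deleteVerts {v}).WalkReachable a b := by
  have hle : (H.deleteVerts {v}).componentSets.encard ≤ 1 := by
    have := not_lt.1 fun hlt ↦ hcut ⟨hv, hlt⟩
    rwa [h.componentSets_eq, Set.encard_singleton] at this
  have hsub := Set.encard_le_one_iff.1 hle _ _
    ⟨a, by simp [ha, hav], rfl⟩ ⟨b, by simp [hb, hbv], rfl⟩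
  have hmem : b ∈ {y | (H.deleteVerts {v}).WalkReachable b y} := WalkReachable.refl _ b
  rw [← hsub] at hmem
  exact hmem

lemma IsConnected.exists_not_walkReachable (h : H.IsConnected) (hcut : H.IsCutVertex u) (v : α) :
    ∃ b ∈ V(H), b ≠ u ∧ ¬ (H.deleteVerts {u}).WalkReachable b v := by
  by_contra! hall
  refine hcut.2.not_ge ?_
  rw [h.componentSets_eq, Set.encard_singleton, Set.encard_le_one_iff]
  have key : ∀ C ∈ (H.deleteVerts {u}).componentSets,
      C = {y | (H.deleteVerts {u}).WalkReachable v y} := by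
    rintro _ ⟨x, hx, rfl⟩
    simp only [vertexSet_deleteVerts, Set.mem_sdiff, Set.mem_singleton_iff] at hx
    have hr := hall x hx.1 hx.2
    ext y
    exact ⟨fun hy ↦ hr.symm.trans hy, fun hy ↦ hr.trans hy⟩
  intro C D hC hD
  rw [key C hC, key D hD]

/-! ### Terminal blocks -/

/-- The subgraph induced by `v` and the component of `a` in `H ∖ v`. -/
def lobe (H : Graph α β) (v a : α) : Graph α β :=
  H.induce (insert v {y | (H.deleteVerts {v}).WalkReachable a y})

lemma lobe_isInducedSubgraph (hv : v ∈ V(H)) (ha : a ∈ V(H)) : H.lobe v a ≤i H where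
  le := by
    refine induce_le ?_
    rintro x (rfl | hx)
    · exact hv
    · exact (WalkReachable.of_deleteVerts hx).mem ha
  isLink_of_mem_mem e x y h hx hy := ⟨h, hx, hy⟩

lemma lobe_adj (hx : x ∈ V(H.lobe v a)) (hy : y ∈ V(H.lobe v a)) (h : H.Adj x y) :
    (H.lobe v a).Adj x y := by
  obtain ⟨e, he⟩ := h
  exact ⟨e, he, hx, hy⟩

lemma mem_lobe_of_adj (hav : a ≠ v) (hx : (H.deleteVerts {v}).WalkReachable a x)
    (h : H.Adj x y) : y ∈ V(H.lobe v a) := by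
  by_cases hy : y = v
  · exact .inl hy
  · exact .inr (hx.trans
      (deleteVerts_singleton_adj.2 ⟨h, hx.ne_of_deleteVerts hav, hy⟩).walkReachable)

lemma lobe_deleteVerts_walkReachable (hav : a ≠ v) (hx : (H.deleteVerts {v}).WalkReachable a x) :
    ((H.lobe v a).deleteVerts {v}).WalkReachable a x := by
  induction hx with
  | refl => exact .refl _ _
  | @tail b c hab hbc ih =>
    have hbc' := deleteVerts_singleton_adj.1 hbc
    exact ih.trans (deleteVerts_singleton_adj.2 ⟨lobe_adj (.inr hab)
      (mem_lobe_of_adj hav hab hbc'.1) hbc'.1, hbc'.2⟩).walkReachable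

lemma lobe_isConnected (hav : a ≠ v) (hr : H.WalkReachable a v) : (H.lobe v a).IsConnected := by
  have key : ∀ x ∈ V(H.lobe v a), (H.lobe v a).WalkReachable a x := by
    rintro x (rfl | hx)
    · rcases hr.deleteVerts_or hav with ⟨hv, -⟩ | ⟨n, hn, han⟩
      · exact absurd rfl hv
      · exact (lobe_deleteVerts_walkReachable hav han).of_deleteVerts.trans
          (lobe_adj (.inr han) (.inl rfl) hn).walkReachable
    · exact (lobe_deleteVerts_walkReachable hav hx).of_deleteVerts
  exact ⟨⟨v, .inl rfl⟩, fun x hx y hy ↦ (key x hx).symm.trans (key y hy)⟩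

/-- Maximality: a larger non-separable `K` stays connected without `v`, so its other vertices all
lie in the component of `a`. -/
lemma lobe_isBlock (hv : v ∈ V(H)) (ha : a ∈ V(H)) (hav : a ≠ v) (hr : H.WalkReachable a v)
    (hcut : ∀ u, ¬ (H.lobe v a).IsCutVertex u) : H.IsBlock (H.lobe v a) := by
  have hind := lobe_isInducedSubgraph hv ha
  refine ⟨⟨hind.le, lobe_isConnected hav hr, hcut⟩, ?_⟩
  rintro K ⟨hKH, hKc, hKcut⟩ hle
  refine hind.le_of_le_subset hKH fun w hw ↦ ?_
  by_cases hwv : w = v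
  · exact .inl hwv
  · exact .inr ((hKc.walkReachable_deleteVerts (hle.vertexSet_mono (.inl rfl)) (hKcut v)
      (hle.vertexSet_mono (.inr (.refl _ _))) hw hav hwv).mono (deleteVerts_mono hKH v))

/-- All neighbours of `u` lie in the lobe, which has no cut vertex, so a walk through `u` can be
rerouted around it inside the lobe. -/
lemma not_isCutVertex_of_mem_lobe (hv : v ∈ V(H)) (ha : a ∈ V(H)) (hav : a ≠ v)
    (hr : H.WalkReachable a v) (hcut : ∀ u, ¬ (H.lobe v a).IsCutVertex u)
    (hu : (H.deleteVerts {v}).WalkReachable a u) : ¬ H.IsCutVertex u := by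
  refine not_isCutVertex_of_walkReachable fun x _ y _ hxu hyu hxy ↦ ?_
  rcases hxy.deleteVerts_or hxu with h | ⟨n, hn, hxn⟩
  · exact h.2
  rcases hxy.symm.deleteVerts_or hyu with h | ⟨m, hm, hym⟩
  · exact h.2.symm
  have hnm := (lobe_isConnected hav hr).walkReachable_deleteVerts (.inr hu) (hcut u)
    (mem_lobe_of_adj hav hu hn.symm) (mem_lobe_of_adj hav hu hm.symm)
    (hxn.ne_of_deleteVerts hxu) (hym.ne_of_deleteVerts hyu)
  exact (hxn.trans (hnm.mono (deleteVerts_mono (lobe_isInducedSubgraph hv ha).le u))).trans hym.symm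

/-- A component of `H ∖ v` attached to `v` and missing `Z` contains, up to a change of `v`, all
vertices but one of a block none of whose other vertices is a cut vertex. -/
lemma exists_lobe_isBlock (hfin : V(H).Finite) (hv : v ∈ V(H)) (ha : a ∈ V(H)) (hav : a ≠ v)
    (hr : H.WalkReachable a v) (hZ : ∀ z ∈ Z, ¬ (H.deleteVerts {v}).WalkReachable a z) :
    ∃ v a, v ∈ V(H) ∧ a ∈ V(H) ∧ a ≠ v ∧ H.WalkReachable a v ∧
      (∀ z ∈ Z, ¬ (H.deleteVerts {v}).WalkReachable a z) ∧ H.IsBlock (H.lobe v a) ∧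
      ∀ u, (H.deleteVerts {v}).WalkReachable a u → ¬ H.IsCutVertex u := by
  induction hn : {y | (H.deleteVerts {v}).WalkReachable a y}.ncard using Nat.strong_induction_on
    generalizing v a with
  | _ n ih =>
    by_cases hcut : ∀ u, ¬ (H.lobe v a).IsCutVertex u
    · exact ⟨v, a, hv, ha, hav, hr, hZ, lobe_isBlock hv ha hav hr hcut,
        fun u hu ↦ not_isCutVertex_of_mem_lobe hv ha hav hr hcut hu⟩
    -- A cut vertex `u` of the lobe is not `v`, and it separates some `b` from `v`. The component of
    -- `b` in `H ∖ u` lies in that of `a` in `H ∖ v` but omits `u`, so it is smaller and still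
    -- misses `Z`.
    push Not at hcut
    obtain ⟨u, hu⟩ := hcut
    have hconn := lobe_isConnected hav hr
    have huC : (H.deleteVerts {v}).WalkReachable a u := by
      rcases hu.1 with rfl | h
      · obtain ⟨b, hb, hbu, hnr⟩ := hconn.exists_not_walkReachable hu a
        rcases hb with rfl | hb
        · exact absurd rfl hbu
        · exact absurd (lobe_deleteVerts_walkReachable hav hb).symm hnr
      · exact h
    have huv := huC.ne_of_deleteVerts hav
    obtain ⟨b, hb, hbu, hnr⟩ := hconn.exists_not_walkReachable hu v
    have hbC : (H.deleteVerts {v}).WalkReachable a b := by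
      rcases hb with rfl | h
      · exact absurd (.refl _ _) hnr
      · exact h
    -- A walk from `b` avoiding `u` can leave the lobe only through `v`, and reaching `v` would
    -- contradict `hnr`.
    have key : ∀ y, (H.deleteVerts {u}).WalkReachable b y →
        (H.deleteVerts {v}).WalkReachable a y ∧
          ((H.lobe v a).deleteVerts {u}).WalkReachable b y := by
      intro y hy
      induction hy with
      | refl => exact ⟨hbC, .refl _ _⟩
      | @tail c d hbc hcd ih =>
        have hcd' := deleteVerts_singleton_adj.1 hcd
        have hd := mem_lobe_of_adj hav ih.1 hcd'.1
        have hbd := ih.2.trans (deleteVerts_singleton_adj.2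
          ⟨lobe_adj (.inr ih.1) hd hcd'.1, hcd'.2⟩).walkReachable
        rcases hd with rfl | hd
        · exact absurd hbd hnr
        · exact ⟨hd, hbd⟩
    have hle := (lobe_isInducedSubgraph hv ha).le
    refine ih _ ?_ (huC.of_deleteVerts.mem ha) (hbC.of_deleteVerts.mem ha) hbu
      ((hconn.2 b hb u hu.1).mono hle) (fun z hz h ↦ hZ z hz (key z h).1) rfl
    rw [← hn]
    refine Set.ncard_lt_ncard ⟨fun y hy ↦ (key y hy).1, fun hsub ↦ ?_⟩
      (hfin.subset fun y hy ↦ (WalkReachable.of_deleteVerts hy).mem ha)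
    exact WalkReachable.ne_of_deleteVerts (hsub huC) hbu rfl

/-- If the components, end blocks and isolated blocks of `H` are tied down on `Z`, then so are the
components of `H ∖ v` for each vertex `v`. -/
lemma exists_walkReachable_deleteVerts (hfin : V(H).Finite)
    (hcomp : ∀ a ∈ V(H), ∃ z ∈ Z, H.WalkReachable a z)
    (hend : ∀ B, H.IsEndBlock B → (internalVerts B H ∩ Z).Nonempty)
    (hiso : ∀ B, H.IsIsolatedBlock B → (H.IsConnected → B = H) →
      V(B).Subsingleton ∨ (V(B) ∩ Z).Nontrivial)
    (hv : v ∈ V(H)) (ha : a ∈ V(H)) (hav : a ≠ v) :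
    ∃ z ∈ Z, (H.deleteVerts {v}).WalkReachable a z := by
  by_contra! hZ
  have hr : H.WalkReachable a v := by
    obtain ⟨z, hz, haz⟩ := hcomp a ha
    rcases haz.deleteVerts_or hav with h | ⟨n, hn, han⟩
    · exact absurd h.2 (hZ z hz)
    · exact han.of_deleteVerts.trans hn.walkReachable
  obtain ⟨v, a, hv, ha, hav, hr, hZ, hB, hcut⟩ := exists_lobe_isBlock hfin hv ha hav hr hZ
  -- Only `v` can be a cut vertex of `H` in this block: the block is an end block if it is one, and
  -- isolated otherwise.
  by_cases hvc : H.IsCutVertex v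
  · obtain ⟨z, ⟨hzB, -, hzc⟩, hz⟩ := hend (H.lobe v a) ⟨hB, v, ⟨.inl rfl, hvc⟩, by
      rintro u ⟨rfl | hu, huc⟩
      · rfl
      · exact absurd huc (hcut u hu)⟩
    rcases hzB with rfl | h
    · exact hzc hvc
    · exact hZ z hz h
  · have hind := lobe_isInducedSubgraph hv ha
    -- Needed for block trees, whose isolated-block condition speaks only of `H` itself.
    have hBH : H.IsConnected → H.lobe v a = H := fun hc ↦ hind.ext_of_vertexSet
      (hind.le.vertexSet_mono.antisymm fun w hw ↦ by
        by_cases hwv : w = v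
        · exact .inl hwv
        · exact .inr (hc.walkReachable_deleteVerts hv hvc ha hw hav hwv))
    have hBiso : H.IsIsolatedBlock (H.lobe v a) := ⟨hB, by
      rintro u (rfl | hu)
      · exact hvc
      · exact hcut u hu⟩
    rcases hiso _ hBiso hBH with h | h
    · exact hav (h (.inr (.refl _ _)) (.inl rfl))
    · obtain ⟨z, ⟨hzB, hz⟩, hzv⟩ := h.exists_ne v
      exact hZ z hz (hzB.resolve_left hzv)

/-! ### Tied forests -/

/-- The subgraphs of `G` containing `Z` in which each component contains exactly one vertex of `Y`,
and in which each component left after the deletion of a vertex meets `Z`. -/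
def tiedForests (G : Graph α β) (Z Y : Set α) : Set (Graph α β) :=
  {H | H ≤ G ∧ Z ⊆ V(H) ∧ (∀ a ∈ V(H), ∃ y ∈ Y, H.WalkReachable a y) ∧
    (∀ y ∈ Y, ∀ y' ∈ Y, H.WalkReachable y y' → y = y') ∧
    ∀ v ∈ V(H), ∀ a ∈ V(H), a ≠ v → ∃ z ∈ Z, (H.deleteVerts {v}).WalkReachable a z}

lemma blockForests_subset_tiedForests (hfin : V(G).Finite) (m : ℕ) (X Y : Set α) :
    G.blockForests m X Y ⊆ G.tiedForests (X ∪ Y) Y := by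
  rintro H ⟨hle, -, hV, hY, hend, hiso⟩
  have hcomp : ∀ a ∈ V(H), ∃ y ∈ Y, H.WalkReachable a y := by
    intro a ha
    obtain ⟨y, hy, -⟩ := hY _ ⟨a, ha, rfl⟩
    exact ⟨y, hy.2, hy.1⟩
  refine ⟨hle, hV, hcomp, fun y hy y' hy' hr ↦ ?_, fun v hv a ha hav ↦ ?_⟩
  · exact (hY _ ⟨y, hV (.inr hy), rfl⟩).unique ⟨.refl _ _, hy⟩ ⟨hr, hy'⟩
  · refine exists_walkReachable_deleteVerts (hfin.subset hle.vertexSet_mono) (fun a ha ↦ ?_) hend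
      (fun B hB _ ↦ (hiso B hB).imp_left ?_) hv ha hav
    · obtain ⟨y, hy, h⟩ := hcomp a ha
      exact ⟨y, .inr hy, h⟩
    · rintro ⟨y, -, rfl⟩
      exact Set.subsingleton_singleton

lemma blockTrees_subset_tiedForests (hfin : V(G).Finite) (m : ℕ) (hx : x ∈ X) :
    G.blockTrees m X ⊆ G.tiedForests X {x} := by
  rintro H ⟨hle, -, hV, hconn, hend, hblock⟩
  refine ⟨hle, hV, fun a ha ↦ ⟨x, rfl, hconn.2 a ha x (hV hx)⟩, ?_, fun v hv a ha hav ↦ ?_⟩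
  · rintro y rfl y' rfl -
    rfl
  · refine exists_walkReachable_deleteVerts (hfin.subset hle.vertexSet_mono)
      (fun a ha ↦ ⟨x, hx, hconn.2 a ha x (hV hx)⟩) hend (fun B hB hBH ↦ ?_) hv ha hav
    obtain rfl := hBH hconn
    refine (hblock hB.1).imp_left ?_
    rintro ⟨y, rfl⟩
    exact Set.subsingleton_singleton

/-- The edges of `H` joining `x` to a component of `H ∖ x` which meets `Y`. -/
def rootEdges (H : Graph α β) (x : α) (Y : Set α) : Set β :=
  {e | ∃ n, H.IsLink e n x ∧ ∃ y ∈ Y, (H.deleteVerts {x}).WalkReachable n y}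

lemma rootEdges_subset_edgeSet : H.rootEdges x Y ⊆ E(H) := by
  rintro e ⟨n, hn, -⟩
  exact hn.edge_mem

lemma rootEdges_subset_incidenceSet (hle : H ≤ G) : H.rootEdges x Y ⊆ G.incidenceSet x := by
  rintro e ⟨n, hn, -⟩
  exact (hn.mono hle).inc_right

lemma deleteVerts_le_deleteEdges_rootEdges :
    H.deleteVerts {x} ≤ H.deleteEdges (H.rootEdges x Y) := by
  refine ⟨?_, fun e a b h ↦ ?_⟩
  · simp
  · simp only [deleteVerts_isLink, Set.mem_singleton_iff] at h
    rw [deleteEdges_isLink]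
    refine ⟨h.1, ?_⟩
    rintro ⟨n, hn, -⟩
    rcases hn.symm.left_eq_or_eq h.1 with rfl | rfl
    · exact h.2.1 rfl
    · exact h.2.2 rfl

/-- On a walk from the root of `x` to `x`, the edge that first enters `x` is a root edge. -/
lemma rootEdges_nonempty (hH : H ∈ G.tiedForests Z Y) (hx : x ∈ Z) (hxY : x ∉ Y) :
    (H.rootEdges x Y).Nonempty := by
  obtain ⟨-, hZ, hex, -⟩ := hH
  obtain ⟨y, hy, hxy⟩ := hex x (hZ hx)
  have hyx : y ≠ x := by
    rintro rfl
    exact hxY hy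
  rcases hxy.symm.deleteVerts_or hyx with ⟨h, -⟩ | ⟨n, ⟨e, he⟩, hn⟩
  · exact absurd rfl h
  · exact ⟨e, n, he, y, hy, hn.symm⟩

/-- Every walk from `Y` first enters `x` by a root edge, so the deletion cuts `x` off from `Y`; what
hung on `x` by other edges keeps `x` as root. A tie broken by the deletion is replaced by an end of
a deleted edge. -/
lemma deleteEdges_rootEdges_mem_tiedForests (hH : H ∈ G.tiedForests Z Y) (hx : x ∈ Z)
    (hxY : x ∉ Y) :
    H.deleteEdges (H.rootEdges x Y) ∈
      G.tiedForests (Z ∪ {a | ∃ e ∈ H.rootEdges x Y, G.Inc e a}) (insert x Y) := by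
  obtain ⟨hle, hZ, hex, huniq, htied⟩ := hH
  have hne : ∀ y ∈ Y, y ≠ x := by
    rintro y hy rfl
    exact hxY hy
  have hle' : H.deleteEdges (H.rootEdges x Y) ≤ H := deleteEdges_le
  have hsep : ∀ y ∈ Y, ¬ (H.deleteEdges (H.rootEdges x Y)).WalkReachable y x := by
    intro y hy hr
    rcases hr.deleteVerts_or (hne y hy) with ⟨h, -⟩ | ⟨n, ⟨e, he⟩, hn⟩
    · exact h rfl
    · rw [deleteEdges_isLink] at he
      exact he.2 ⟨n, he.1, y, hy, (hn.mono (deleteVerts_mono hle' x)).symm⟩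
  refine ⟨hle'.trans hle, ?_, fun a ha ↦ ?_, ?_, fun v hv a ha hav ↦ ?_⟩
  · rintro a (ha | ⟨e, he, hea⟩)
    · exact hZ ha
    · exact ((hle.inc_congr (rootEdges_subset_edgeSet he)).2 hea).vertex_mem
  · by_cases hax : a = x
    · exact ⟨x, Set.mem_insert _ _, hax ▸ .refl _ _⟩
    obtain ⟨y, hy, hay⟩ := hex a ha
    rcases hay.deleteVerts_or hax with ⟨-, h⟩ | ⟨n, ⟨e, he⟩, hn⟩
    · exact ⟨y, .inr hy, h.mono deleteVerts_le_deleteEdges_rootEdges⟩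
    · by_cases heS : e ∈ H.rootEdges x Y
      · obtain ⟨n', hn', y', hy', hr⟩ := heS
        obtain rfl := hn'.left_unique he
        exact ⟨y', .inr hy', (hn.trans hr).mono deleteVerts_le_deleteEdges_rootEdges⟩
      · refine ⟨x, Set.mem_insert _ _, (hn.mono deleteVerts_le_deleteEdges_rootEdges).trans
          (Adj.walkReachable ⟨e, ?_⟩)⟩
        rw [deleteEdges_isLink]
        exact ⟨he, heS⟩
  · rintro y (rfl | hy) y' (rfl | hy') hr
    · rfl
    · exact absurd hr.symm (hsep y' hy')
    · exact absurd hr (hsep y hy)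
    · exact huniq y hy y' hy' (hr.mono hle')
  · obtain ⟨z, hz, hr⟩ := htied v hv a ha hav
    clear ha hav
    -- Follow the walk to `z` until its first deleted edge: the near end of that edge belongs to the
    -- enlarged tie set.
    induction hr using Relation.ReflTransGen.head_induction_on with
    | refl => exact ⟨z, .inl hz, .refl _ _⟩
    | @head b c hbc _ ih =>
      obtain ⟨⟨e, he⟩, hbc⟩ := deleteVerts_singleton_adj.1 hbc
      by_cases heS : e ∈ H.rootEdges x Y
      · exact ⟨b, .inr ⟨e, heS, (he.mono hle).inc_left⟩, .refl _ _⟩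
      · obtain ⟨z', hz', hr⟩ := ih
        refine ⟨z', hz', (Adj.walkReachable (deleteVerts_singleton_adj.2 ⟨⟨e, ?_⟩, hbc⟩)).trans hr⟩
        rw [deleteEdges_isLink]
        exact ⟨he, heS⟩

/-- For a vertex `a ∉ Y`, deleting its root would leave `a` tied to a second vertex of `Y` in the
same component. So all vertices are roots, and an edge would join two of them. -/
lemma tiedForests_self_subset (hG : G.Loopless) : G.tiedForests Y Y ⊆ {Graph.noEdge Y β} := by
  rintro H ⟨hle, hY, hex, huniq, htied⟩
  have hV : V(H) ⊆ Y := by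
    intro a ha
    obtain ⟨y, hy, hay⟩ := hex a ha
    by_cases hne : a = y
    · exact hne ▸ hy
    obtain ⟨z, hz, haz⟩ := htied y (hY hy) a ha hne
    exact absurd (huniq z hz y hy (haz.of_deleteVerts.symm.trans hay))
      (haz.ne_of_deleteVerts hne)
  refine ((le_noEdge_iff (X := Y)).2 ⟨hV, ?_⟩).antisymm (noEdge_le_iff.2 hY)
  refine Set.eq_empty_of_forall_notMem fun e he ↦ ?_
  obtain ⟨a, b, hab⟩ := exists_isLink_of_mem_edgeSet he
  exact (hab.mono hle).ne (huniq a (hV hab.left_mem) b (hV hab.right_mem) hab.adj.walkReachable)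

/-! ### Weights -/

lemma setOf_le_finite (hV : V(G).Finite) (hE : E(G).Finite) : {H | H ≤ G}.Finite := by
  refine Set.Finite.of_injOn (f := fun H : Graph α β ↦ (V(H), E(H)))
    (t := (𝒫 V(G)) ×ˢ (𝒫 E(G))) ?_ ?_ (hV.finite_subsets.prod hE.finite_subsets)
  · intro H hH
    exact ⟨hH.vertexSet_mono, hH.edgeSet_mono⟩
  · intro H hH K hK heq
    simp only [Prod.mk.injEq] at heq
    exact Compatible.ext heq.1 heq.2 (.of_le_le hH hK)

lemma weight_nonneg {w : β → ℝ} (hw : ∀ e ∈ E(G), 0 ≤ w e) (hle : H ≤ G) : 0 ≤ weight w H :=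
  finprod_induction (p := fun r : ℝ ↦ 0 ≤ r) zero_le_one (fun _ _ ↦ mul_nonneg)
    fun e ↦ finprod_induction (p := fun r : ℝ ↦ 0 ≤ r) zero_le_one (fun _ _ ↦ mul_nonneg)
      fun he ↦ hw e (hle.edgeSet_mono he)

lemma weight_eq_prod_mul (w : β → ℝ) (hE : E(H).Finite) (S : Finset β) (hS : (S : Set β) ⊆ E(H)) :
    weight w H = (∏ e ∈ S, w e) * weight w (H.deleteEdges S) := by
  have hE' : E(H.deleteEdges S) = E(H) \ S := by simp
  rw [weight, weight, hE', ← finprod_mem_coe_finset,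
    ← finprod_mem_union Set.disjoint_sdiff_right S.finite_toSet hE.sdiff,
    Set.union_sdiff_cancel hS]

/-- The source of `ln 2`: `∏ (1 + w e) ≤ exp (∑ w e) ≤ 2`, and the empty set accounts for `1`. -/
lemma sum_powerset_erase_empty_le {w : β → ℝ} (I : Finset β) (hw : ∀ e ∈ I, 0 ≤ w e)
    (hI : ∑ e ∈ I, w e ≤ Real.log 2) [DecidableEq β] :
    ∑ S ∈ I.powerset.erase ∅, ∏ e ∈ S, w e ≤ 1 := by
  have h1 := Finset.sum_erase_add I.powerset (fun S ↦ ∏ e ∈ S, w e) (Finset.empty_mem_powerset I)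
  rw [← Finset.prod_one_add, Finset.prod_empty] at h1
  have h2 : ∏ e ∈ I, (1 + w e) ≤ ∏ e ∈ I, Real.exp (w e) :=
    Finset.prod_le_prod (fun e he ↦ by linarith [hw e he])
      fun e _ ↦ by linarith [Real.add_one_le_exp (w e)]
  rw [← Real.exp_sum] at h2
  have h3 := (Real.exp_le_exp.2 hI).trans_eq (Real.exp_log two_pos)
  linarith

open Classical in
lemma sum_tiedForests_le_one {w : β → ℝ} (hG : G.IsWeightedMultigraph w)
    (hdeg : ∀ x ∈ V(G), G.weightedDegree w x ≤ Real.log 2) {Z Y : Set α} (hYZ : Y ⊆ Z)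
    (hZ : Z ⊆ V(G)) (F : Finset (Graph α β)) (hF : (F : Set (Graph α β)) ⊆ G.tiedForests Z Y) :
    ∑ H ∈ F, weight w H ≤ 1 := by
  have hVfin := hG.finite_vertexSet
  have hEfin := hG.finite_edgeSet
  induction hn : (V(G) \ Y).ncard using Nat.strong_induction_on generalizing Z Y F with
  | _ n ih =>
    by_cases hZY : Z ⊆ Y
    · obtain rfl := hYZ.antisymm hZY
      have hsub : F ⊆ {Graph.noEdge Y β} := by
        intro H hH
        exact Finset.mem_singleton.2 (tiedForests_self_subset hG.loopless (hF hH))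
      refine (Finset.sum_le_sum_of_subset_of_nonneg hsub ?_).trans ?_
      · intro H hH _
        rw [Finset.mem_singleton.1 hH]
        simp [weight]
      · simp [weight]
    obtain ⟨x, hx, hxY⟩ := Set.not_subset.1 hZY
    have hIfin : (G.incidenceSet x).Finite := hEfin.subset (G.incidenceSet_subset_edgeSet x)
    set I := hIfin.toFinset with hI
    have hwI : ∀ e ∈ I, 0 ≤ w e := fun e he ↦
      hG.weight_nonneg e (G.incidenceSet_subset_edgeSet x (hIfin.mem_toFinset.1 he))
    set g : Graph α β → Finset β := fun H ↦ I.filter (· ∈ H.rootEdges x Y) with hg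
    have hgS : ∀ H ∈ F, (g H : Set β) = H.rootEdges x Y := by
      intro H hH
      ext e
      simp only [hg, Finset.coe_filter, Set.mem_ofPred_eq, and_iff_right_iff_imp]
      exact fun he ↦ hIfin.mem_toFinset.2 (rootEdges_subset_incidenceSet (hF hH).1 he)
    have hmaps : ∀ H ∈ F, g H ∈ I.powerset.erase ∅ := by
      intro H hH
      refine Finset.mem_erase.2 ⟨fun h0 ↦ ?_, Finset.mem_powerset.2 (Finset.filter_subset _ _)⟩
      have := rootEdges_nonempty (hF hH) hx hxY
      rw [← hgS H hH, h0] at this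
      simp at this
    rw [← Finset.sum_fiberwise_of_maps_to hmaps]
    -- Within the fibre of a fixed root-edge set `S`, the factor `∏ w` over `S` comes out and the
    -- induction hypothesis bounds the rest by `1`.
    refine le_trans (Finset.sum_le_sum (g := fun S ↦ ∏ e ∈ S, w e) fun S hS ↦ ?_)
      (sum_powerset_erase_empty_le I hwI ?_)
    · have hmem : ∀ H ∈ F.filter (fun H ↦ g H = S), H ∈ F ∧ H.rootEdges x Y = S := by
        intro H hH
        obtain ⟨hHF, hHS⟩ := Finset.mem_filter.1 hH
        exact ⟨hHF, by rw [← hgS H hHF, hHS]⟩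
      have hinj : Set.InjOn (fun H : Graph α β ↦ H.deleteEdges S)
          (F.filter (fun H ↦ g H = S) : Finset (Graph α β)) := by
        intro H hH K hK heq
        obtain ⟨hHF, hHS⟩ := hmem H hH
        obtain ⟨hKF, hKS⟩ := hmem K hK
        have hV : V(H.deleteEdges S) = V(K.deleteEdges S) := congrArg _ heq
        have hE : E(H.deleteEdges S) = E(K.deleteEdges S) := congrArg _ heq
        simp only [vertexSet_deleteEdges, edgeSet_deleteEdges] at hV hE
        refine Compatible.ext hV ?_ (.of_le_le (hF hHF).1 (hF hKF).1)
        rw [← Set.sdiff_union_of_subset (hHS ▸ rootEdges_subset_edgeSet : (S : Set β) ⊆ E(H)),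
          ← Set.sdiff_union_of_subset (hKS ▸ rootEdges_subset_edgeSet : (S : Set β) ⊆ E(K)), hE]
      have hsum : ∑ H ∈ F.filter (fun H ↦ g H = S), weight w H =
          (∏ e ∈ S, w e) *
            ∑ K ∈ (F.filter (fun H ↦ g H = S)).image (fun H ↦ H.deleteEdges S), weight w K := by
        rw [Finset.sum_image hinj, Finset.mul_sum]
        refine Finset.sum_congr rfl fun H hH ↦ ?_
        obtain ⟨hHF, hHS⟩ := hmem H hH
        exact weight_eq_prod_mul w (hEfin.subset (hF hHF).1.edgeSet_mono) S
          (hHS ▸ rootEdges_subset_edgeSet)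
      rw [hsum]
      have hSI : S ⊆ I := Finset.mem_powerset.1 (Finset.mem_of_mem_erase hS)
      refine mul_le_of_le_one_right (Finset.prod_nonneg fun e he ↦ hwI e (hSI he)) ?_
      refine ih _ ?_ (Z := Z ∪ {a | ∃ e ∈ (S : Set β), G.Inc e a}) (Y := insert x Y) ?_ ?_ _ ?_ rfl
      · rw [← hn]
        refine Set.ncard_lt_ncard ⟨Set.sdiff_subset_sdiff_right (Set.subset_insert _ _),
          fun hsub ↦ ?_⟩ hVfin.sdiff
        exact (hsub ⟨hZ hx, hxY⟩).2 (Set.mem_insert _ _)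
      · exact Set.insert_subset (.inl hx) (hYZ.trans Set.subset_union_left)
      · rintro a (ha | ⟨e, -, he⟩)
        · exact hZ ha
        · exact he.vertex_mem
      · intro K hK
        obtain ⟨H, hH, rfl⟩ := Finset.mem_image.1 hK
        obtain ⟨hHF, hHS⟩ := hmem H hH
        rw [← hHS]
        exact deleteEdges_rootEdges_mem_tiedForests (hF hHF) hx hxY
    · rw [← finsum_mem_coe_finset, hI, Set.Finite.coe_toFinset]
      exact hdeg x (hZ hx)

/-! ### Generating functions -/

lemma weight_const_mul (w : β → ℝ) (ζ : ℝ) {m : ℕ} (hm : E(H).encard = m) :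
    weight (fun e ↦ ζ * w e) H = ζ ^ m * weight w H := by
  have hfin : E(H).Finite := Set.finite_of_encard_eq_coe hm
  have hcard : hfin.toFinset.card = m := by
    rw [hfin.encard_eq_coe_toFinset_card] at hm
    exact_mod_cast hm
  rw [weight, weight, finprod_mem_eq_finite_toFinset_prod _ hfin,
    finprod_mem_eq_finite_toFinset_prod _ hfin, Finset.prod_mul_distrib, Finset.prod_const, hcard]

lemma IsWeightedMultigraph.const_mul {w : β → ℝ} (hG : G.IsWeightedMultigraph w) {ζ : ℝ}
    (hζ : 0 ≤ ζ) : G.IsWeightedMultigraph fun e ↦ ζ * w e :=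
  ⟨hG.finite_vertexSet, hG.finite_edgeSet, hG.loopless,
    fun e he ↦ mul_nonneg hζ (hG.weight_nonneg e he)⟩

lemma weightedDegree_const_mul (hE : E(G).Finite) (w : β → ℝ) (ζ : ℝ) (x : α) :
    G.weightedDegree (fun e ↦ ζ * w e) x = ζ * G.weightedDegree w x := by
  have hfin : (G.incidenceSet x).Finite := hE.subset (G.incidenceSet_subset_edgeSet x)
  rw [weightedDegree, weightedDegree, finsum_mem_eq_finite_toFinset_sum _ hfin,
    finsum_mem_eq_finite_toFinset_sum _ hfin, Finset.mul_sum]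

lemma IsWeightedMultigraph.weightedDegree_le {w : β → ℝ} (hG : G.IsWeightedMultigraph w)
    (hx : x ∈ V(G)) : G.weightedDegree w x ≤ G.maxWeightedDegree w :=
  le_csSup (hG.finite_vertexSet.image _).bddAbove ⟨x, hx, rfl⟩

lemma IsWeightedMultigraph.weightedDegree_nonneg {w : β → ℝ} (hG : G.IsWeightedMultigraph w)
    (x : α) : 0 ≤ G.weightedDegree w x :=
  finsum_nonneg fun e ↦ finsum_nonneg fun he ↦ hG.weight_nonneg e (G.incidenceSet_subset_edgeSet x he)

open Classical in
/-- A family of sets of tied forests, graded by the number of edges, has generating function at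
most `1` at `(ln 2) / Δ`. -/
lemma summable_and_tsum_le_one {w : β → ℝ} (hG : G.IsWeightedMultigraph w) (hYZ : Y ⊆ Z)
    (hZ : Z ⊆ V(G)) (hY : Y.Nonempty) (A : ℕ → Set (Graph α β))
    (hA : ∀ m, A m ⊆ G.tiedForests Z Y) (hm : ∀ m, ∀ H ∈ A m, E(H).encard = m) :
    Summable (fun m : ℕ ↦ (G.maxWeightedDegree w / Real.log 2) ^ (-(m : ℤ)) *
      ∑ᶠ H ∈ A m, weight w H) ∧
    ∑' m : ℕ, (G.maxWeightedDegree w / Real.log 2) ^ (-(m : ℤ)) *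
      ∑ᶠ H ∈ A m, weight w H ≤ 1 := by
  -- Absorbing `ζ` into the weights brings all degrees to at most `ln 2`. If `Δ = 0` then `ζ = 0⁻¹ =
  -- 0`, which kills the terms with `m ≥ 1`.
  set ζ := (G.maxWeightedDegree w / Real.log 2)⁻¹ with hζdef
  obtain ⟨y, hy⟩ := hY
  have hlog : 0 < Real.log 2 := Real.log_pos one_lt_two
  have hΔ : 0 ≤ G.maxWeightedDegree w :=
    (hG.weightedDegree_nonneg y).trans (hG.weightedDegree_le (hZ (hYZ hy)))
  have hζ : 0 ≤ ζ := inv_nonneg.2 (div_nonneg hΔ hlog.le)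
  have hG' := hG.const_mul hζ
  have hdeg : ∀ x ∈ V(G), G.weightedDegree (fun e ↦ ζ * w e) x ≤ Real.log 2 := by
    intro x hx
    rw [weightedDegree_const_mul hG.finite_edgeSet]
    refine (mul_le_mul_of_nonneg_left (hG.weightedDegree_le hx) hζ).trans ?_
    rw [hζdef, inv_div]
    rcases eq_or_ne (G.maxWeightedDegree w) 0 with h | h
    · simpa [h] using hlog.le
    · exact (div_mul_cancel₀ _ h).le
  have hfin : ∀ m, (A m).Finite := fun m ↦
    (setOf_le_finite hG.finite_vertexSet hG.finite_edgeSet).subset fun H hH ↦ (hA m hH).1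
  have hterm : ∀ m : ℕ, (G.maxWeightedDegree w / Real.log 2) ^ (-(m : ℤ)) *
      ∑ᶠ H ∈ A m, weight w H = ∑ H ∈ (hfin m).toFinset, weight (fun e ↦ ζ * w e) H := by
    intro m
    rw [zpow_neg, zpow_natCast, ← inv_pow, ← hζdef, finsum_mem_eq_finite_toFinset_sum _ (hfin m),
      Finset.mul_sum]
    refine Finset.sum_congr rfl fun H hH ↦ ?_
    rw [weight_const_mul w ζ (hm m H ((hfin m).mem_toFinset.1 hH))]
  simp only [hterm]
  have hnonneg : ∀ m, 0 ≤ ∑ H ∈ (hfin m).toFinset, weight (fun e ↦ ζ * w e) H := fun m ↦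
    Finset.sum_nonneg fun H hH ↦
      Graph.weight_nonneg hG'.weight_nonneg (hA m ((hfin m).mem_toFinset.1 hH)).1
  have hle : ∀ s : Finset ℕ,
      ∑ m ∈ s, ∑ H ∈ (hfin m).toFinset, weight (fun e ↦ ζ * w e) H ≤ 1 := by
    intro s
    rw [← Finset.sum_biUnion]
    · refine sum_tiedForests_le_one hG' hdeg hYZ hZ _ fun H hH ↦ ?_
      obtain ⟨m, -, hH⟩ := Finset.mem_biUnion.1 hH
      exact hA m ((hfin m).mem_toFinset.1 hH)
    · intro m _ n _ hmn
      refine Finset.disjoint_left.2 fun H hHm hHn ↦ hmn ?_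
      have := (hm m H ((hfin m).mem_toFinset.1 hHm)).symm.trans
        (hm n H ((hfin n).mem_toFinset.1 hHn))
      exact_mod_cast this
  exact ⟨summable_of_sum_le hnonneg hle, Real.tsum_le_of_sum_le hnonneg hle⟩

/-! ### Bananas -/

lemma banana_isNonSeparable {S : Set β} (hS : S.Nonempty) :
    (banana false true S).IsNonSeparable := by
  obtain ⟨e, he⟩ := hS
  have hadj : (banana false true S).Adj false true := ⟨e, by simp [he]⟩
  have hconn : (banana false true S).IsConnected := by
    refine ⟨⟨true, by simp⟩, ?_⟩
    rintro (_ | _) - (_ | _) -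
    · exact .refl _ _
    · exact hadj.walkReachable
    · exact hadj.symm.walkReachable
    · exact .refl _ _
  refine ⟨hconn, ?_⟩
  rintro x ⟨-, hlt⟩
  rw [hconn.componentSets_eq, Set.encard_singleton] at hlt
  refine hlt.not_ge (Set.encard_le_one_iff.2 ?_)
  rintro _ _ ⟨a, ha, rfl⟩ ⟨b, hb, rfl⟩
  obtain rfl : a = b := by
    have ha' := ha.2
    have hb' := hb.2
    revert ha' hb'
    cases a <;> cases b <;> cases x <;> simp
  rfl

lemma IsNonSeparable.eq_of_isBlock (h : H.IsNonSeparable) (hB : H.IsBlock K) : K = H :=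
  hB.eq_of_le ⟨le_rfl, h⟩ hB.prop.1

lemma IsNonSeparable.not_isEndBlock (h : H.IsNonSeparable) : ¬ H.IsEndBlock K := by
  rintro ⟨-, x, ⟨-, hx⟩, -⟩
  exact h.2 x hx

lemma vertexSet_banana_inter_nontrivial (S : Set β) {X : Set Bool} (h0 : false ∈ X)
    (h1 : true ∈ X) : (V(banana false true S) ∩ X).Nontrivial :=
  ⟨false, ⟨by simp, h0⟩, true, ⟨by simp, h1⟩, by simp⟩

lemma banana_mem_blockTrees {S T : Set β} (hST : S ⊆ T) (hS : S.Nonempty) {m : ℕ}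
    (hm : S.encard = m) :
    banana false true S ∈ (banana false true T).blockTrees m {false, true} := by
  have hns := banana_isNonSeparable hS
  exact ⟨(IsSpanningSubgraph.banana_mono hST).le, by simpa using hm, by simp,
    hns.1, fun B hB ↦ absurd hB hns.not_isEndBlock,
    fun _ ↦ .inr (vertexSet_banana_inter_nontrivial S (by simp) (by simp))⟩

lemma banana_mem_blockForests {S T : Set β} (hST : S ⊆ T) (hS : S.Nonempty) {m : ℕ}
    (hm : S.encard = m) :
    banana false true S ∈ (banana false true T).blockForests m {false} {true} := by
  have hns := banana_isNonSeparable hS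
  refine ⟨(IsSpanningSubgraph.banana_mono hST).le, by simpa using hm,
    by simp [Set.insert_subset_iff], fun C hC ↦ ?_, fun B hB ↦ absurd hB hns.not_isEndBlock, fun B hB ↦ .inr ?_⟩
  · rw [hns.1.componentSets_eq] at hC
    obtain rfl := hC
    exact ⟨true, by simp, by simp⟩
  · rw [hns.eq_of_isBlock hB.1]
    exact vertexSet_banana_inter_nontrivial S (by simp) (by simp)

lemma banana_isWeightedMultigraph (n : ℕ) {c : ℝ} (hc : 0 ≤ c) :
    (banana false true (Set.univ : Set (Fin n))).IsWeightedMultigraph fun _ ↦ c := by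
  refine ⟨Set.toFinite _, Set.toFinite _, ?_, fun _ _ ↦ hc⟩
  rw [loopless_iff_forall_ne_of_adj]
  rintro u v ⟨e, he⟩ rfl
  cases u <;> simp at he

lemma maxWeightedDegree_banana (n : ℕ) (c : ℝ) :
    (banana false true (Set.univ : Set (Fin n))).maxWeightedDegree (fun _ ↦ c) = n * c := by
  have hdeg : ∀ x, (banana false true (Set.univ : Set (Fin n))).weightedDegree (fun _ ↦ c) x =
      n * c := by
    intro x
    have hinc : (banana false true (Set.univ : Set (Fin n))).incidenceSet x = Set.univ := by
      ext e
      cases x <;> simp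
    rw [weightedDegree, hinc, finsum_mem_univ, finsum_eq_sum_of_fintype]
    simp
  have himg : (banana false true (Set.univ : Set (Fin n))).weightedDegree (fun _ ↦ c) ''
      V(banana false true (Set.univ : Set (Fin n))) = {n * c} := by
    ext r
    simp [hdeg]
  rw [maxWeightedDegree, himg, csSup_singleton]

lemma summable_and_one_lt_tsum_banana {n : ℕ} {c ζ : ℝ} (hc : 0 ≤ c) (hζ : 0 ≤ ζ)
    (hlt : 2 < (1 + ζ * c) ^ n) (A : ℕ → Set (Graph Bool (Fin n)))
    (hA : ∀ m, ∀ H ∈ A m, H ≤ banana false true Set.univ ∧ E(H).encard = m)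
    (hmem : ∀ S : Finset (Fin n), S.Nonempty → banana false true (S : Set (Fin n)) ∈ A S.card) :
    Summable (fun m : ℕ ↦ ζ ^ m * ∑ᶠ H ∈ A m, weight (fun _ ↦ c) H) ∧
      1 < ∑' m : ℕ, ζ ^ m * ∑ᶠ H ∈ A m, weight (fun _ ↦ c) H := by
  classical
  have hG := banana_isWeightedMultigraph n hc
  have hfin : ∀ m, (A m).Finite := fun m ↦
    (setOf_le_finite hG.finite_vertexSet hG.finite_edgeSet).subset fun H hH ↦ (hA m H hH).1
  have hnonneg : ∀ m, ∀ H ∈ A m, 0 ≤ weight (fun _ ↦ c) H := fun m H hH ↦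
    weight_nonneg hG.weight_nonneg (hA m H hH).1
  have hzero : ∀ m ∉ Finset.range (n + 1), ζ ^ m * ∑ᶠ H ∈ A m, weight (fun _ ↦ c) H = 0 := by
    intro m hmn
    have hempty : A m = ∅ := by
      refine Set.eq_empty_of_forall_notMem fun H hH ↦ hmn ?_
      have h1 := (hA m H hH).2
      have h2 : E(H).encard ≤ n := by
        simpa using Set.encard_le_encard (Set.subset_univ E(H))
      rw [h1] at h2
      exact Finset.mem_range_succ_iff.2 (by exact_mod_cast h2)
    rw [hempty, finsum_mem_empty, mul_zero]
  refine ⟨summable_of_ne_finset_zero hzero, ?_⟩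
  have hge : ∀ m, m ≠ 0 →
      (n.choose m : ℝ) * c ^ m ≤ ∑ᶠ H ∈ A m, weight (fun _ ↦ c) H := by
    intro m hm0
    have hinj : Set.InjOn (fun S : Finset (Fin n) ↦ banana false true (S : Set (Fin n)))
        (Finset.powersetCard m Finset.univ : Finset (Finset (Fin n))) := by
      intro S _ T _ heq
      have : E(banana false true (S : Set (Fin n))) = E(banana false true (T : Set (Fin n))) :=
        congrArg _ heq
      simpa using this
    have hw : ∀ S ∈ Finset.powersetCard m (Finset.univ : Finset (Fin n)),
        weight (fun _ ↦ c) (banana false true (S : Set (Fin n))) = c ^ m := by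
      intro S hS
      rw [weight, edgeSet_banana, finprod_mem_coe_finset, Finset.prod_const,
        (Finset.mem_powersetCard.1 hS).2]
    rw [finsum_mem_eq_finite_toFinset_sum _ (hfin m)]
    refine le_trans (le_of_eq ?_) (Finset.sum_le_sum_of_subset_of_nonneg
      (s := (Finset.powersetCard m Finset.univ).image
        fun S : Finset (Fin n) ↦ banana false true (S : Set (Fin n))) ?_
      fun H hH _ ↦ hnonneg m H ((hfin m).mem_toFinset.1 hH))
    · rw [Finset.sum_image hinj, Finset.sum_congr rfl hw, Finset.sum_const,
        Finset.card_powersetCard, Finset.card_univ, Fintype.card_fin, nsmul_eq_mul]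
    · intro H hH
      obtain ⟨S, hS, rfl⟩ := Finset.mem_image.1 hH
      have hcard := (Finset.mem_powersetCard.1 hS).2
      have := hmem S (Finset.card_ne_zero.1 (hcard ▸ hm0))
      rw [hcard] at this
      exact (hfin m).mem_toFinset.2 this
  rw [tsum_eq_sum hzero, Finset.sum_range_succ']
  have h0 : 0 ≤ ζ ^ 0 * ∑ᶠ H ∈ A 0, weight (fun _ ↦ c) H :=
    mul_nonneg (by positivity) (finsum_nonneg fun H ↦ finsum_nonneg (hnonneg 0 H))
  have hbinom : (1 + ζ * c) ^ n =
      ∑ m ∈ Finset.range n, ζ ^ (m + 1) * ((n.choose (m + 1) : ℝ) * c ^ (m + 1)) + 1 := by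
    rw [add_comm 1, add_pow, Finset.sum_range_succ']
    simp only [one_pow, mul_one, pow_zero, Nat.choose_zero_right, Nat.cast_one, mul_pow]
    congr 1
    exact Finset.sum_congr rfl fun m _ ↦ by ring
  have hsum := Finset.sum_le_sum fun m (_ : m ∈ Finset.range n) ↦
    mul_le_mul_of_nonneg_left (hge (m + 1) m.succ_ne_zero) (pow_nonneg hζ (m + 1))
  linarith

end Graph

end

theorem proposition7p1 :
    -- the bounds for block forests and for block trees, in every weighted multigraph
    (∀ (α : Type u) (β : Type v) (G : Graph α β) (w : β → ℝ), G.IsWeightedMultigraph w →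
      (∀ X Y : Set α, X ⊆ V(G) → Y ⊆ V(G) → Y.Nonempty →
        Summable (fun m : ℕ =>
          (G.maxWeightedDegree w / Real.log 2) ^ (-(m : ℤ)) * G.blockForestCount w m X Y) ∧
        ∑' m : ℕ, (G.maxWeightedDegree w / Real.log 2) ^ (-(m : ℤ)) *
          G.blockForestCount w m X Y ≤ 1) ∧
      (∀ X : Set α, X ⊆ V(G) → X.Nonempty →
        Summable (fun m : ℕ =>
          (G.maxWeightedDegree w / Real.log 2) ^ (-(m : ℤ)) * G.blockTreeCount w m X) ∧
        ∑' m : ℕ, (G.maxWeightedDegree w / Real.log 2) ^ (-(m : ℤ)) *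
          G.blockTreeCount w m X ≤ 1)) ∧
    -- sharpness: no `ζ > (ln 2) / Δ` allows the upper bound 1
    (∀ D ζ : ℝ, 0 < D → Real.log 2 / D < ζ →
      ∃ (α β : Type) (G : Graph α β) (w : β → ℝ),
        G.IsWeightedMultigraph w ∧ G.maxWeightedDegree w = D ∧
        (∃ X Y : Set α, X ⊆ V(G) ∧ Y ⊆ V(G) ∧ Y.Nonempty ∧
          Summable (fun m : ℕ => ζ ^ m * G.blockForestCount w m X Y) ∧
          1 < ∑' m : ℕ, ζ ^ m * G.blockForestCount w m X Y) ∧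
        (∃ X : Set α, X ⊆ V(G) ∧ X.Nonempty ∧
          Summable (fun m : ℕ => ζ ^ m * G.blockTreeCount w m X) ∧
          1 < ∑' m : ℕ, ζ ^ m * G.blockTreeCount w m X)) := by
  refine ⟨fun α β G w hG ↦ ⟨fun X Y hX hY hYne ↦ ?_, fun X hX hXne ↦ ?_⟩, fun D ζ hD hζ ↦ ?_⟩
  · exact Graph.summable_and_tsum_le_one hG Set.subset_union_right (Set.union_subset hX hY) hYne
      (fun m ↦ G.blockForests m X Y)
      (fun m ↦ Graph.blockForests_subset_tiedForests hG.finite_vertexSet m X Y)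
      (fun m H hH ↦ hH.2.1)
  · obtain ⟨x, hx⟩ := hXne
    exact Graph.summable_and_tsum_le_one hG (Set.singleton_subset_iff.2 hx) hX
      (Set.singleton_nonempty x) (fun m ↦ G.blockTrees m X)
      (fun m ↦ Graph.blockTrees_subset_tiedForests hG.finite_vertexSet m hx)
      (fun m H hH ↦ hH.2.1)
  · have hζ0 : 0 < ζ := (div_pos (Real.log_pos one_lt_two) hD).trans hζ
    have hexp : 2 < Real.exp (ζ * D) :=
      (Real.log_lt_iff_lt_exp two_pos).1 ((div_lt_iff₀ hD).1 hζ)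
    obtain ⟨n, hn, hn0⟩ := (((Real.tendsto_one_add_div_pow_exp (ζ * D)).eventually_const_lt
      hexp).and (Filter.eventually_ge_atTop 1)).exists
    have hn0' : (n : ℝ) ≠ 0 := by positivity
    rw [mul_div_assoc] at hn
    refine ⟨Bool, Fin n, Graph.banana false true Set.univ, fun _ ↦ D / n,
      Graph.banana_isWeightedMultigraph n (by positivity), ?_,
      ⟨{false}, {true}, by simp, by simp, by simp, ?_⟩,
      ⟨{false, true}, by simp, by simp, ?_⟩⟩
    · rw [Graph.maxWeightedDegree_banana, mul_div_cancel₀ _ hn0']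
    · exact Graph.summable_and_one_lt_tsum_banana (by positivity) hζ0.le hn
        (fun m ↦ (Graph.banana false true Set.univ).blockForests m {false} {true})
        (fun m H hH ↦ ⟨hH.1, hH.2.1⟩)
        (fun S hS ↦ Graph.banana_mem_blockForests (Set.subset_univ _) hS (by simp))
    · exact Graph.summable_and_one_lt_tsum_banana (by positivity) hζ0.le hn
        (fun m ↦ (Graph.banana false true Set.univ).blockTrees m {false, true})
        (fun m H hH ↦ ⟨hH.1, hH.2.1⟩)
        (fun S hS ↦ Graph.banana_mem_blockTrees (Set.subset_univ _) hS (by simp))
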